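/- Let $X$ be a CAT(0) space: a geodesic metric space in which the distance between any two points of a geodesic triangle is at most the distance between the corresponding points of the model triangle with the same side lengths in the Euclidean plane. (Completeness is not assumed.) Let $I$ be a time interval of the form $[0,\infty)$, $[0,T)$ or $[0,T]$. A \emph{continuous-time simple pursuit} in $X$ on $I$ consists of an evader curve $E:I\to X$ and a pursuer curve $P:I\to X$ such that $E$ is rectifiable with speed at most $1$ (i.e. $E$ is $1$-Lipschitz), $P$ has constant unit speed (is parametrized by arclength), and, for every $t\in I$ other than a possible final time, $P(t)\ne E(t)$ and the right-hand velocity vector $P'(t)$ exists and is the unit vector pointing along the geodesic from $P(t)$ to $E(t)$. The last condition means that, if $\sigma$ is the unit-speed geodesic with $\sigma(0)=P(t)$ that ends at $E(t)$, then $d(P(t+h),\sigma(h))/h\to 0$ as $h\downarrow 0$. Thus the pursuit runs until capture, which may occur at the final time of $I$. For a polygonal (piecewise geodesic) curve $\sigma$ with nontrivial sides, its total rotation is $\sum_i(\pi-\beta_i)$, where the $\beta_i$ are the angles at its interior vertices. The total curvature of a curve $\gamma$ is the $\limsup$, as $\mu_\sigma\to0$, of the total rotations of the polygonal curves $\sigma$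 inscribed in $\gamma$, where $\mu_\sigma$ is the maximal length of a segment of $\sigma$; its value lies in $[0,\infty]$. Denote by $\tau^P(t)$ and $\tau^E(t)$ the total curvatures of $P|_{[0,t]}$ and $E|_{[0,t]}$. \textbf{Theorem.} For every continuous-time simple pursuit on a CAT(0) space as above, and every $t\in I$, $$\tau^P(t)\le\tau^E(t)+\pi .$$ -/

import Mathlib

open Set Filter Topology
open scoped NNReal ENNReal

noncomputable section

namespace Pursuit

section Spaces

variable {X : Type*} [MetricSpace X]

/-- `σ`, restricted to `[0, dist p q]`, is a (unit-speed, minimizing) geodesic from `p` to `q`.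
The values of `σ` outside `[0, dist p q]` play no role. -/
structure IsGeodesic (σ : ℝ → X) (p q : X) : Prop where
  source : σ 0 = p
  target : σ (dist p q) = q
  isometric : ∀ s ∈ Icc 0 (dist p q), ∀ t ∈ Icc 0 (dist p q), dist (σ s) (σ t) = |s - t|

/-- The angle at the vertex corresponding to `p` in the Euclidean triangle with the same side
lengths as the triple `p, x, y` (law of cosines; meaningful for `x ≠ p`, `y ≠ p`). -/
def comparisonAngle (p x y : X) : ℝ :=
  Real.arccos ((dist p x ^ 2 + dist p y ^ 2 - dist x y ^ 2) / (2 * dist p x * dist p y))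

/-- The angle at `p` between the geodesic segments from `p` to `x` and from `p` to `y`
(for `x ≠ p`, `y ≠ p`): the greatest lower bound of the comparison angles of the triangles
formed by nontrivial initial subsegments. In a CAT(0) space the geodesics are unique. -/
def geodesicAngle (p x y : X) : ℝ :=
  sInf {θ : ℝ | ∃ σ ρ : ℝ → X, IsGeodesic σ p x ∧ IsGeodesic ρ p y ∧
    ∃ s ∈ Ioc 0 (dist p x), ∃ t ∈ Ioc 0 (dist p y), θ = comparisonAngle p (σ s) (ρ t)}

variable (X) in
/-- CAT(0) spaces: geodesic metric spaces in which the distance between two points of a geodesic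
triangle is at most the distance between the corresponding points of the model triangle with the
same side lengths in the Euclidean plane. (Any two distinct sides share a vertex, which is called
`p` here; two points on the same side satisfy the inequality trivially.) -/
structure IsCAT0 : Prop where
  geodesic : ∀ p q : X, ∃ σ : ℝ → X, IsGeodesic σ p q
  comparison : ∀ (p q r : X) (σ ρ : ℝ → X), IsGeodesic σ p q → IsGeodesic ρ p r →
    ∀ p' q' r' : EuclideanSpace ℝ (Fin 2),
      dist p' q' = dist p q → dist p' r' = dist p r → dist q' r' = dist q r →
      ∀ a ∈ Icc (0 : ℝ) 1, ∀ b ∈ Icc (0 : ℝ) 1,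
        dist (σ (a * dist p q)) (ρ (b * dist p r)) ≤
          dist (AffineMap.lineMap p' q' a) (AffineMap.lineMap p' r' b)

end Spaces

section TotalCurvature

variable {X : Type*} [MetricSpace X]

/-- A polygonal curve inscribed in the curve `γ : [a, b] → X`: it is given by its vertices
`γ (t 0), …, γ (t n)` at parameters `a = t 0 ≤ … ≤ t n = b`, and consecutive vertices are
distinct, so that every side is a nontrivial geodesic segment. Values `t i` with `i > n` play no
role. -/
structure InscribedPolygon (γ : ℝ → X) (a b : ℝ) where
  n : ℕ
  t : ℕ → ℝ
  first : t 0 = a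
  last : t n = b
  mono : ∀ i < n, t i ≤ t (i + 1)
  nondegenerate : ∀ i < n, γ (t i) ≠ γ (t (i + 1))

namespace InscribedPolygon

variable {γ : ℝ → X} {a b : ℝ}

/-- The `i`-th vertex (for `i ≤ n`). -/
def vertex (σ : InscribedPolygon γ a b) (i : ℕ) : X :=
  γ (σ.t i)

/-- The maximal length of a segment. -/
def mesh (σ : InscribedPolygon γ a b) : ℝ≥0 :=
  (Finset.range σ.n).sup fun i => nndist (σ.vertex i) (σ.vertex (i + 1))

/-- The total rotation: the sum of `π - β` over the angles `β` at the interior vertices. -/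
def rotation (σ : InscribedPolygon γ a b) : ℝ :=
  ∑ i ∈ Finset.range (σ.n - 1),
    (Real.pi - geodesicAngle (σ.vertex (i + 1)) (σ.vertex i) (σ.vertex (i + 2)))

end InscribedPolygon

/-- The total curvature of the curve `γ : [a, b] → X`: the upper limit of the total rotation of
inscribed polygonal curves, as their maximal segment length tends to `0`. It may be infinite. -/
def totalCurvature (γ : ℝ → X) (a b : ℝ) : ℝ≥0∞ :=
  limsup (fun σ : InscribedPolygon γ a b => ENNReal.ofReal σ.rotation)
    (comap InscribedPolygon.mesh (𝓝 0))

end TotalCurvature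

section Pursuit

variable {X : Type*} [MetricSpace X]

/-- At time `t` the curve `P` has a right-hand velocity vector, and this is the unit vector
pointing along a (nontrivial) geodesic `σ` from `P t` to `q`: that is,
`dist (P (t + h)) (σ h) = o(h)` as `h ↓ 0`. -/
def HasRightVelocityToward (P : ℝ → X) (t : ℝ) (q : X) : Prop :=
  P t ≠ q ∧ ∃ σ : ℝ → X, IsGeodesic σ (P t) q ∧
    Tendsto (fun h : ℝ => dist (P (t + h)) (σ h) / h) (𝓝[>] 0) (𝓝 0)

/-- Continuous-time simple pursuit of the evader `E` by the pursuer `P` during the time interval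
`I`: `E` has speed at most one (hence is rectifiable on compact time intervals), `P` has constant
unit speed (is parametrized by arclength), and at each time other than a possible final one the
right-hand velocity of `P` exists and points along a geodesic from `P t` to `E t`.
The direction only makes sense before capture; capture may occur at the final time. -/
structure IsSimplePursuit (E P : ℝ → X) (I : Set ℝ) : Prop where
  evader_speed : LipschitzOnWith 1 E I
  pursuer_speed : HasUnitSpeedOn P I
  pursues : ∀ t ∈ I, (∃ u ∈ I, t < u) → HasRightVelocityToward P t (E t)

end Pursuit

end Pursuit

end

namespace Pursuit

/-! ### Euclidean comparison and geodesics. -/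

section Angles

variable {X : Type*} [MetricSpace X]

/-! The pursuit is replaced by an alternation of two elementary moves: a point `q` slides towards
the present position of the evader, then the evader jumps along a side of a polygon inscribed in its
curve. Two quantities are followed.

The budget is `V q = π + R - ∠(E u, q)`, the angle being taken at `E s`; `R` is the rotation of the
evader's polygon so far and `E u`, `E s` are the ends of its last side. A slide does not change the
direction of `q` seen from `E s`, hence not `V q`. A jump to `E s'` raises the budget by at least
the angle at `q` between `E s` and `E s'`: this is the bound `π` on the angle sum of the triangle
`q, E s, E s'`, with the triangle inequality for angles at `E s` (`Budget.step`).

The expense is the rotation already made by the polygon of the pursuer, plus the deviation of `q`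
from its current side. Angle sums again show that a slide does not increase it (`deviation_slide`),
and a jump increases it by at most the same angle at `q` (`deviation_evader`). So the expense never
exceeds the budget, and the budget never exceeds `π + R` once the evader has moved; before that it
is `0`.

To pass to the true pursuer, sliding two points by equal lengths towards a common target does not
separate them (`dist_toward_le`), so the errors of the moves only add up. By the right-hand velocity
condition they are `o(h)`, and a continuous induction makes their sum as small as desired
(`chase_segment`). Any prescribed inscribed polygon of `P` is thus approximated, vertex by vertex,
by a polygon of such points `q`. Angles are upper semicontinuous, so its rotation is at most that of
the approximation plus an arbitrarily small error. -/

theorem exists_model_triangle {a b c : ℝ} (ha : 0 ≤ a) (hb : 0 ≤ b) (hc : 0 ≤ c)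
    (h1 : a ≤ b + c) (h2 : b ≤ a + c) (h3 : c ≤ a + b) :
    ∃ p q r : EuclideanSpace ℝ (Fin 2), dist p q = a ∧ dist p r = b ∧ dist q r = c := by
  rcases ha.eq_or_lt with rfl | ha
  · obtain rfl : b = c := by linarith
    refine ⟨!₂[0, 0], !₂[0, 0], !₂[b, 0], ?_, ?_, ?_⟩ <;>
      simp [EuclideanSpace.dist_eq, Real.dist_eq, Real.sqrt_sq hb]
  -- `x` is the first coordinate of the third vertex when the side of length `a` lies on the first
  -- axis; Heron's factorization gives `x ^ 2 ≤ b ^ 2`.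
  · set x := (a ^ 2 + b ^ 2 - c ^ 2) / (2 * a) with hx
    have hxa : 2 * a * x = a ^ 2 + b ^ 2 - c ^ 2 := by rw [hx]; field_simp
    have hy : 0 ≤ b ^ 2 - x ^ 2 := by
      have h4 : 0 ≤ (b + c - a) * (a + c - b) * ((a + b - c) * (a + b + c)) := by
        have := sub_nonneg.2 h1
        have := sub_nonneg.2 h2
        have := sub_nonneg.2 h3
        positivity
      have h5 : (2 * a) ^ 2 * (b ^ 2 - x ^ 2) =
          (b + c - a) * (a + c - b) * ((a + b - c) * (a + b + c)) := by
        linear_combination (-(2 * a * x) - (a ^ 2 + b ^ 2 - c ^ 2)) * hxa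
      rw [← h5] at h4
      exact nonneg_of_mul_nonneg_right h4 (by positivity)
    refine ⟨!₂[0, 0], !₂[a, 0], !₂[x, √(b ^ 2 - x ^ 2)], ?_, ?_, ?_⟩
    · simp [EuclideanSpace.dist_eq, Real.dist_eq, Real.sqrt_sq ha.le]
    · simp [EuclideanSpace.dist_eq, Real.dist_eq, Real.sq_sqrt hy, Real.sqrt_sq hb]
    · have : (a - x) ^ 2 + (b ^ 2 - x ^ 2) = c ^ 2 := by linear_combination -hxa
      simp [EuclideanSpace.dist_eq, Real.dist_eq, Real.sq_sqrt hy, this, Real.sqrt_sq hc]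

namespace IsGeodesic

variable {σ : ℝ → X} {p q : X}

theorem dist_source (h : IsGeodesic σ p q) {s : ℝ} (hs : s ∈ Icc 0 (dist p q)) :
    dist p (σ s) = s := by
  have := h.isometric 0 ⟨le_rfl, dist_nonneg⟩ s hs
  rwa [h.source, zero_sub, abs_neg, abs_of_nonneg hs.1] at this

theorem dist_target (h : IsGeodesic σ p q) {s : ℝ} (hs : s ∈ Icc 0 (dist p q)) :
    dist (σ s) q = dist p q - s := by
  have := h.isometric s hs _ ⟨dist_nonneg, le_rfl⟩
  rwa [h.target, abs_sub_comm, abs_of_nonneg (sub_nonneg.2 hs.2)] at this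

theorem initial (h : IsGeodesic σ p q) {s : ℝ} (hs : s ∈ Icc 0 (dist p q)) :
    IsGeodesic σ p (σ s) := by
  have hd := h.dist_source hs
  refine ⟨h.source, by rw [hd], fun u hu v hv => ?_⟩
  rw [hd] at hu hv
  exact h.isometric u ⟨hu.1, hu.2.trans hs.2⟩ v ⟨hv.1, hv.2.trans hs.2⟩

theorem reverse (h : IsGeodesic σ p q) : IsGeodesic (fun u => σ (dist p q - u)) q p := by
  refine ⟨by simp [h.target], by simp [dist_comm q p, h.source], fun u hu v hv => ?_⟩
  rw [dist_comm q p] at hu hv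
  rw [h.isometric _ ⟨by linarith [hu.2], by linarith [hu.1]⟩ _
    ⟨by linarith [hv.2], by linarith [hv.1]⟩, abs_sub_comm]
  congr 1; ring

end IsGeodesic

namespace IsCAT0

variable (hX : IsCAT0 X)
include hX

/-- The coordinate-free form of the comparison inequality: the right side is the squared distance in
the model triangle, expanded by the law of cosines. -/
theorem comparison_sq {p q r : X} {σ ρ : ℝ → X} (hσ : IsGeodesic σ p q) (hρ : IsGeodesic ρ p r)
    {a b : ℝ} (ha : a ∈ Icc (0 : ℝ) 1) (hb : b ∈ Icc (0 : ℝ) 1) :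
    dist (σ (a * dist p q)) (ρ (b * dist p r)) ^ 2 ≤
      a ^ 2 * dist p q ^ 2 + b ^ 2 * dist p r ^ 2 -
        a * b * (dist p q ^ 2 + dist p r ^ 2 - dist q r ^ 2) := by
  obtain ⟨p', q', r', h1, h2, h3⟩ := exists_model_triangle (dist_nonneg (x := p) (y := q))
    (dist_nonneg (x := p) (y := r)) (dist_nonneg (x := q) (y := r))
    (by rw [dist_comm q r]; exact dist_triangle _ _ _) (dist_triangle _ _ _)
    (by rw [dist_comm p q]; exact dist_triangle _ _ _)
  have h := hX.comparison p q r σ ρ hσ hρ p' q' r' h1 h2 h3 a ha b hb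
  refine (pow_le_pow_left₀ dist_nonneg h 2).trans_eq ?_
  rw [← h1, ← h2, ← h3, dist_comm p' q', dist_comm p' r', dist_eq_norm, dist_eq_norm, dist_eq_norm,
    dist_eq_norm, AffineMap.lineMap_apply, AffineMap.lineMap_apply]
  have e1 : (a • (q' -ᵥ p') +ᵥ p') - (b • (r' -ᵥ p') +ᵥ p') = a • (q' - p') - b • (r' - p') := by
    simp
  have e2 : q' - r' = (q' - p') - (r' - p') := by abel
  rw [e1, e2, @norm_sub_sq_real _ _ _ (a • (q' - p')), @norm_sub_sq_real _ _ _ (q' - p'),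
    norm_smul, norm_smul, real_inner_smul_left, real_inner_smul_right, mul_pow, mul_pow,
    Real.norm_eq_abs, Real.norm_eq_abs, sq_abs, sq_abs]
  ring

theorem geodesic_unique {p q : X} {σ ρ : ℝ → X} (hσ : IsGeodesic σ p q) (hρ : IsGeodesic ρ p q)
    {s : ℝ} (hs : s ∈ Icc 0 (dist p q)) : σ s = ρ s := by
  rcases eq_or_ne p q with rfl | hpq
  · obtain rfl : s = 0 := by simpa using hs
    rw [hσ.source, hρ.source]
  · have hd := dist_pos.2 hpq
    have hm : s / dist p q ∈ Icc (0 : ℝ) 1 := ⟨div_nonneg hs.1 hd.le, (div_le_one hd).2 hs.2⟩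
    have h := hX.comparison_sq hσ hρ hm hm
    rw [div_mul_cancel₀ _ hd.ne', dist_self] at h
    refine dist_le_zero.1 (le_of_sq_le_sq (b := 0) ?_ le_rfl)
    linarith

end IsCAT0

/-! ### Comparison angles and angles between geodesics. -/

theorem comparisonAngle_comm (p x y : X) : comparisonAngle p x y = comparisonAngle p y x := by
  unfold comparisonAngle
  rw [dist_comm x y]
  congr 1
  ring

theorem geodesicAngle_comm (p x y : X) : geodesicAngle p x y = geodesicAngle p y x := by
  unfold geodesicAngle
  congr 1
  ext θ
  constructor <;> rintro ⟨σ, ρ, hσ, hρ, s, hs, t, ht, rfl⟩ <;>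
    exact ⟨ρ, σ, hρ, hσ, t, ht, s, hs, comparisonAngle_comm _ _ _⟩

theorem bddBelow_comparisonAngles (p x y : X) :
    BddBelow {θ : ℝ | ∃ σ ρ : ℝ → X, IsGeodesic σ p x ∧ IsGeodesic ρ p y ∧
    ∃ s ∈ Ioc 0 (dist p x), ∃ t ∈ Ioc 0 (dist p y), θ = comparisonAngle p (σ s) (ρ t)} := by
  refine ⟨0, ?_⟩
  rintro θ ⟨σ, ρ, hσ, hρ, s, hs, t, ht, rfl⟩
  exact Real.arccos_nonneg _

theorem geodesicAngle_nonneg (p x y : X) : 0 ≤ geodesicAngle p x y := by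
  apply Real.sInf_nonneg
  rintro θ ⟨σ, ρ, hσ, hρ, s, hs, t, ht, rfl⟩
  exact Real.arccos_nonneg _

theorem geodesicAngle_le {p x y : X} {σ ρ : ℝ → X} (hσ : IsGeodesic σ p x) (hρ : IsGeodesic ρ p y)
    {s t : ℝ} (hs : s ∈ Ioc 0 (dist p x)) (ht : t ∈ Ioc 0 (dist p y)) :
    geodesicAngle p x y ≤ comparisonAngle p (σ s) (ρ t) :=
  csInf_le (bddBelow_comparisonAngles p x y) ⟨σ, ρ, hσ, hρ, s, hs, t, ht, rfl⟩

theorem geodesicAngle_le_pi (p x y : X) : geodesicAngle p x y ≤ Real.pi := by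
  rcases eq_empty_or_nonempty {θ : ℝ | ∃ σ ρ : ℝ → X, IsGeodesic σ p x ∧ IsGeodesic ρ p y ∧
    ∃ s ∈ Ioc 0 (dist p x), ∃ t ∈ Ioc 0 (dist p y), θ = comparisonAngle p (σ s) (ρ t)} with h | h
  · rw [geodesicAngle, h, Real.sInf_empty]
    exact Real.pi_pos.le
  · obtain ⟨θ, σ, ρ, hσ, hρ, s, hs, t, ht, rfl⟩ := h
    exact (geodesicAngle_le hσ hρ hs ht).trans (Real.arccos_le_pi _)

theorem comparisonAngle_le_iff {p x y : X} (hx : p ≠ x) (hy : p ≠ y) {θ : ℝ}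
    (hθ : θ ∈ Icc 0 Real.pi) : comparisonAngle p x y ≤ θ ↔
      dist x y ^ 2 ≤ dist p x ^ 2 + dist p y ^ 2 - 2 * dist p x * dist p y * Real.cos θ := by
  have hx := dist_pos.2 hx
  have hy := dist_pos.2 hy
  have hpos : 0 < 2 * dist p x * dist p y := by positivity
  have key : Real.cos θ ≤ (dist p x ^ 2 + dist p y ^ 2 - dist x y ^ 2) / (2 * dist p x * dist p y) ↔
      dist x y ^ 2 ≤ dist p x ^ 2 + dist p y ^ 2 - 2 * dist p x * dist p y * Real.cos θ := by
    rw [le_div_iff₀ hpos]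
    constructor <;> intro h <;> linarith
  rw [← key, comparisonAngle]
  constructor
  · intro h
    set K := (dist p x ^ 2 + dist p y ^ 2 - dist x y ^ 2) / (2 * dist p x * dist p y)
    have hK : -1 ≤ K := by
      rw [le_div_iff₀ hpos]
      have h1 : dist x y ≤ dist p x + dist p y := by
        rw [dist_comm p x]; exact dist_triangle _ _ _
      nlinarith [pow_le_pow_left₀ dist_nonneg h1 2]
    rcases le_total K 1 with h1 | h1
    · rw [← Real.cos_arccos hK h1]
      exact Real.cos_le_cos_of_nonneg_of_le_pi (Real.arccos_nonneg _) hθ.2 h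
    · exact (Real.cos_le_one _).trans h1
  · intro h
    rw [← Real.arccos_cos hθ.1 hθ.2]
    exact Real.antitone_arccos h

theorem continuousAt_comparisonAngle {Z : Type*} [TopologicalSpace Z] {f u v : Z → X} {z : Z}
    (hf : ContinuousAt f z) (hu : ContinuousAt u z) (hv : ContinuousAt v z) (hfu : f z ≠ u z)
    (hfv : f z ≠ v z) : ContinuousAt (fun w => comparisonAngle (f w) (u w) (v w)) z := by
  have h1 := hf.dist hu
  have h2 := hf.dist hv
  have h3 := hu.dist hv
  have := dist_pos.2 hfu
  have := dist_pos.2 hfv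
  exact Real.continuous_arccos.continuousAt.comp (((h1.pow 2).add (h2.pow 2)).sub (h3.pow 2)
    |>.div ((continuousAt_const.mul h1).mul h2) (by positivity))

theorem IsGeodesic.ne_of_mem {p q : X} {σ : ℝ → X} (h : IsGeodesic σ p q) {s : ℝ}
    (hs : s ∈ Ioc 0 (dist p q)) : p ≠ σ s := by
  rw [← dist_pos, h.dist_source (Ioc_subset_Icc_self hs)]
  exact hs.1

namespace IsCAT0

variable (hX : IsCAT0 X)
include hX

theorem comparisonAngle_le_comparisonAngle {p x y : X} {σ ρ : ℝ → X} (hσ : IsGeodesic σ p x)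
    (hρ : IsGeodesic ρ p y) {s t : ℝ} (hs : s ∈ Ioc 0 (dist p x)) (ht : t ∈ Ioc 0 (dist p y)) :
    comparisonAngle p (σ s) (ρ t) ≤ comparisonAngle p x y := by
  have hx := hs.1.trans_le hs.2
  have hy := ht.1.trans_le ht.2
  have h := hX.comparison_sq hσ hρ (a := s / dist p x) (b := t / dist p y)
    ⟨div_nonneg hs.1.le hx.le, (div_le_one hx).2 hs.2⟩
    ⟨div_nonneg ht.1.le hy.le, (div_le_one hy).2 ht.2⟩
  rw [div_mul_cancel₀ _ hx.ne', div_mul_cancel₀ _ hy.ne'] at h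
  unfold comparisonAngle
  apply Real.antitone_arccos
  rw [hσ.dist_source (Ioc_subset_Icc_self hs), hρ.dist_source (Ioc_subset_Icc_self ht)]
  have hs0 := hs.1
  have ht0 := ht.1
  rw [le_div_iff₀ (by positivity)]
  have e1 : (dist p x ^ 2 + dist p y ^ 2 - dist x y ^ 2) / (2 * dist p x * dist p y) * (2 * s * t) =
      s / dist p x * (t / dist p y) * (dist p x ^ 2 + dist p y ^ 2 - dist x y ^ 2) := by
    field_simp
  have e2 : (s / dist p x) ^ 2 * dist p x ^ 2 = s ^ 2 := by field_simp
  have e3 : (t / dist p y) ^ 2 * dist p y ^ 2 = t ^ 2 := by field_simp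
  rw [e1]
  linarith

theorem comparisonAngle_mono {p x y : X} {σ ρ : ℝ → X} (hσ : IsGeodesic σ p x)
    (hρ : IsGeodesic ρ p y) {s t s' t' : ℝ} (hs : 0 < s) (hss : s ≤ s') (hs' : s' ≤ dist p x)
    (ht : 0 < t) (htt : t ≤ t') (ht' : t' ≤ dist p y) :
    comparisonAngle p (σ s) (ρ t) ≤ comparisonAngle p (σ s') (ρ t') := by
  have h1 : s' ∈ Icc 0 (dist p x) := ⟨hs.le.trans hss, hs'⟩
  have h2 : t' ∈ Icc 0 (dist p y) := ⟨ht.le.trans htt, ht'⟩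
  apply hX.comparisonAngle_le_comparisonAngle (hσ.initial h1) (hρ.initial h2)
  · rw [hσ.dist_source h1]; exact ⟨hs, hss⟩
  · rw [hρ.dist_source h2]; exact ⟨ht, htt⟩

theorem geodesicAngle_le_comparisonAngle {p x y : X} (hx : p ≠ x) (hy : p ≠ y) :
    geodesicAngle p x y ≤ comparisonAngle p x y := by
  obtain ⟨σ, hσ⟩ := hX.geodesic p x
  obtain ⟨ρ, hρ⟩ := hX.geodesic p y
  have h := geodesicAngle_le hσ hρ ⟨dist_pos.2 hx, le_rfl⟩ ⟨dist_pos.2 hy, le_rfl⟩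
  rwa [hσ.target, hρ.target] at h

theorem exists_comparisonAngle_lt {p x y : X} (hx : p ≠ x) (hy : p ≠ y) {θ : ℝ}
    (hθ : geodesicAngle p x y < θ) {σ ρ : ℝ → X} (hσ : IsGeodesic σ p x) (hρ : IsGeodesic ρ p y) :
    ∃ s ∈ Ioc 0 (dist p x), ∃ t ∈ Ioc 0 (dist p y), comparisonAngle p (σ s) (ρ t) < θ := by
  have hne : {θ : ℝ | ∃ σ ρ : ℝ → X, IsGeodesic σ p x ∧ IsGeodesic ρ p y ∧
      ∃ s ∈ Ioc 0 (dist p x), ∃ t ∈ Ioc 0 (dist p y),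
        θ = comparisonAngle p (σ s) (ρ t)}.Nonempty :=
    ⟨_, σ, ρ, hσ, hρ, _, ⟨dist_pos.2 hx, le_rfl⟩, _, ⟨dist_pos.2 hy, le_rfl⟩, rfl⟩
  obtain ⟨_, ⟨σ', ρ', hσ', hρ', s, hs, t, ht, rfl⟩, h⟩ := exists_lt_of_csInf_lt hne hθ
  refine ⟨s, hs, t, ht, ?_⟩
  rwa [hX.geodesic_unique hσ hσ' (Ioc_subset_Icc_self hs),
    hX.geodesic_unique hρ hρ' (Ioc_subset_Icc_self ht)]

/-- By monotonicity of comparison angles, the infimum is determined by arbitrarily short initial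
pieces of the sides. -/
theorem geodesicAngle_initial {p x y : X} {σ : ℝ → X} (hσ : IsGeodesic σ p x) (hy : p ≠ y)
    {s : ℝ} (hs : s ∈ Ioc 0 (dist p x)) : geodesicAngle p (σ s) y = geodesicAngle p x y := by
  have hx : p ≠ x := dist_pos.1 (hs.1.trans_le hs.2)
  obtain ⟨ρ, hρ⟩ := hX.geodesic p y
  have hs' := Ioc_subset_Icc_self hs
  have hd := hσ.dist_source hs'
  apply le_antisymm
  · refine le_of_forall_gt fun θ hθ => ?_
    obtain ⟨u, hu, v, hv, h⟩ := hX.exists_comparisonAngle_lt hx hy hθ hσ hρ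
    have h1 := geodesicAngle_le (hσ.initial hs') hρ (s := min s u) (t := v)
      ⟨lt_min hs.1 hu.1, by rw [hd]; exact min_le_left _ _⟩ hv
    exact (h1.trans (hX.comparisonAngle_mono hσ hρ (lt_min hs.1 hu.1) (min_le_right _ _) hu.2
      hv.1 le_rfl hv.2)).trans_lt h
  · refine le_of_forall_gt fun θ hθ => ?_
    obtain ⟨u, hu, v, hv, h⟩ := hX.exists_comparisonAngle_lt (hσ.ne_of_mem hs) hy hθ
      (hσ.initial hs') hρ
    rw [hd] at hu
    exact (geodesicAngle_le hσ hρ ⟨hu.1, hu.2.trans hs.2⟩ hv).trans_lt h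

theorem geodesicAngle_self {p x : X} (hx : p ≠ x) : geodesicAngle p x x = 0 := by
  refine le_antisymm ((hX.geodesicAngle_le_comparisonAngle hx hx).trans ?_)
    (geodesicAngle_nonneg _ _ _)
  rw [comparisonAngle_le_iff hx hx ⟨le_rfl, Real.pi_pos.le⟩]
  simp only [dist_self, Real.cos_zero]
  nlinarith

theorem angle_sum_le_pi {x y z : X} (hxy : x ≠ y) (hyz : y ≠ z) (hxz : x ≠ z) :
    geodesicAngle x y z + geodesicAngle y x z + geodesicAngle z x y ≤ Real.pi := by
  have h1 := hX.geodesicAngle_le_comparisonAngle hxy hxz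
  have h2 := hX.geodesicAngle_le_comparisonAngle hxy.symm hyz
  have h3 := hX.geodesicAngle_le_comparisonAngle hxz.symm hyz.symm
  obtain ⟨p, q, r, e1, e2, e3⟩ := exists_model_triangle (dist_nonneg (x := x) (y := y))
    (dist_nonneg (x := x) (y := z)) (dist_nonneg (x := y) (y := z))
    (by rw [dist_comm y z]; exact dist_triangle _ _ _) (dist_triangle _ _ _)
    (by rw [dist_comm x y]; exact dist_triangle _ _ _)
  have key : ∀ {p q r : EuclideanSpace ℝ (Fin 2)} {x y z : X}, dist p q = dist x y →
      dist p r = dist x z → dist q r = dist y z →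
      comparisonAngle x y z = EuclideanGeometry.angle q p r := by
    intro p q r x y z e1 e2 e3
    rw [comparisonAngle, EuclideanGeometry.angle, InnerProductGeometry.angle,
      real_inner_eq_norm_mul_self_add_norm_mul_self_sub_norm_sub_mul_self_div_two, ← e1, ← e2, ← e3,
      vsub_eq_sub, vsub_eq_sub, sub_sub_sub_cancel_right, ← dist_eq_norm, ← dist_eq_norm,
      ← dist_eq_norm, dist_comm q p, dist_comm r p, div_div]
    congr 1
    ring
  rw [key e1 e2 e3] at h1
  rw [key (p := q) (q := p) (r := r) (by rw [dist_comm, e1, dist_comm]) e3 e2] at h2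
  rw [key (p := r) (q := p) (r := q) (by rw [dist_comm, e2, dist_comm])
    (by rw [dist_comm, e3, dist_comm]) e1] at h3
  have hqp : p ≠ q := by rw [← dist_pos, e1]; exact dist_pos.2 hxy
  have := EuclideanGeometry.angle_add_angle_add_angle_eq_pi r hqp
  rw [EuclideanGeometry.angle_comm p q r] at h2
  linarith

/-- In the plane, take two points at distance `s` from a vertex on rays enclosing `α + β`, and cut
their chord by the intermediate ray. Comparison bounds the two distances in `X` by the two pieces of
the chord, so the distance between the outer points is at most the whole chord. -/
theorem angle_triangle {p x y z : X} (hx : p ≠ x) (hy : p ≠ y) (hz : p ≠ z) :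
    geodesicAngle p x z ≤ geodesicAngle p x y + geodesicAngle p y z := by
  obtain ⟨σ, hσ⟩ := hX.geodesic p x
  obtain ⟨ρ, hρ⟩ := hX.geodesic p y
  obtain ⟨τ, hτ⟩ := hX.geodesic p z
  have main : ∀ α β, geodesicAngle p x y < α → geodesicAngle p y z < β →
      geodesicAngle p x z ≤ α + β := by
    intro α β hα hβ
    have hα0 : 0 < α := (geodesicAngle_nonneg _ _ _).trans_lt hα
    have hβ0 : 0 < β := (geodesicAngle_nonneg _ _ _).trans_lt hβ
    rcases le_or_gt Real.pi (α + β) with hπ | hπ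
    · exact (geodesicAngle_le_pi _ _ _).trans hπ
    obtain ⟨s₁, hs₁, r₁, hr₁, h₁⟩ := hX.exists_comparisonAngle_lt hx hy hα hσ hρ
    obtain ⟨r₂, hr₂, t₂, ht₂, h₂⟩ := hX.exists_comparisonAngle_lt hy hz hβ hρ hτ
    set s := min (min s₁ r₁) (min r₂ t₂) with hs
    have hs0 : 0 < s := lt_min (lt_min hs₁.1 hr₁.1) (lt_min hr₂.1 ht₂.1)
    have hss₁ : s ≤ s₁ := (min_le_left _ _).trans (min_le_left _ _)
    have hsr₁ : s ≤ r₁ := (min_le_left _ _).trans (min_le_right _ _)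
    have hsr₂ : s ≤ r₂ := (min_le_right _ _).trans (min_le_left _ _)
    have hst₂ : s ≤ t₂ := (min_le_right _ _).trans (min_le_right _ _)
    have ha : 0 < Real.sin α := Real.sin_pos_of_pos_of_lt_pi hα0 (by linarith)
    have hb : 0 < Real.sin β := Real.sin_pos_of_pos_of_lt_pi hβ0 (by linarith)
    have hab : 0 < Real.sin (α + β) := Real.sin_pos_of_pos_of_lt_pi (by linarith) hπ
    have hab' : Real.sin (α + β) ≤ Real.sin α + Real.sin β := by
      rw [Real.sin_add]
      nlinarith [Real.cos_le_one α, Real.cos_le_one β]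
    set S := Real.sin α + Real.sin β with hS
    have hS0 : 0 < S := by positivity
    -- The distance from the vertex at which the intermediate ray meets the chord; it divides the
    -- chord in the ratio `sin α : sin β`.
    set r := s * Real.sin (α + β) / S with hr
    have hr0 : 0 < r := by positivity
    have hrs : r ≤ s := by
      rw [hr, div_le_iff₀ hS0]
      exact mul_le_mul_of_nonneg_left hab' hs0.le
    have hrS : r * S = s * Real.sin (α + β) := by rw [hr]; field_simp
    have hsx : s ∈ Ioc 0 (dist p x) := ⟨hs0, hss₁.trans hs₁.2⟩
    have hry : r ∈ Ioc 0 (dist p y) := ⟨hr0, (hrs.trans hsr₁).trans hr₁.2⟩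
    have hsz : s ∈ Ioc 0 (dist p z) := ⟨hs0, hst₂.trans ht₂.2⟩
    have k₁ := (hX.comparisonAngle_mono hσ hρ hs0 hss₁ hs₁.2 hr0 (hrs.trans hsr₁) hr₁.2).trans h₁.le
    have k₂ := (hX.comparisonAngle_mono hρ hτ hr0 (hrs.trans hsr₂) hr₂.2 hs0 hst₂ ht₂.2).trans h₂.le
    refine (geodesicAngle_le hσ hτ hsx hsz).trans ?_
    rw [comparisonAngle_le_iff (hσ.ne_of_mem hsx) (hρ.ne_of_mem hry) ⟨hα0.le, by linarith⟩,
      hσ.dist_source (Ioc_subset_Icc_self hsx), hρ.dist_source (Ioc_subset_Icc_self hry)] at k₁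
    rw [comparisonAngle_le_iff (hρ.ne_of_mem hry) (hτ.ne_of_mem hsz) ⟨hβ0.le, by linarith⟩,
      hρ.dist_source (Ioc_subset_Icc_self hry), hτ.dist_source (Ioc_subset_Icc_self hsz)] at k₂
    rw [comparisonAngle_le_iff (hσ.ne_of_mem hsx) (hτ.ne_of_mem hsz) ⟨by linarith, hπ.le⟩,
      hσ.dist_source (Ioc_subset_Icc_self hsx), hτ.dist_source (Ioc_subset_Icc_self hsz)]
    have hN : 0 ≤ s ^ 2 + s ^ 2 - 2 * s * s * Real.cos (α + β) := by
      nlinarith [Real.cos_le_one (α + β), sq_nonneg s]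
    set N := s ^ 2 + s ^ 2 - 2 * s * s * Real.cos (α + β) with hNdef
    have hscα := Real.sin_sq_add_cos_sq α
    have hscβ := Real.sin_sq_add_cos_sq β
    have i₁ : s ^ 2 + r ^ 2 - 2 * s * r * Real.cos α = (Real.sin α / S * √N) ^ 2 := by
      rw [mul_pow, Real.sq_sqrt hN, hNdef, hr, hS, Real.sin_add, Real.cos_add]
      rw [hS] at hS0
      generalize Real.sin α = a at *
      generalize Real.sin β = b at *
      generalize Real.cos α = A at *
      generalize Real.cos β = B at *
      field_simp
      clear * - hscα hscβ
      grind
    have i₂ : r ^ 2 + s ^ 2 - 2 * r * s * Real.cos β = (Real.sin β / S * √N) ^ 2 := by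
      rw [mul_pow, Real.sq_sqrt hN, hNdef, hr, hS, Real.sin_add, Real.cos_add]
      rw [hS] at hS0
      generalize Real.sin α = a at *
      generalize Real.sin β = b at *
      generalize Real.cos α = A at *
      generalize Real.cos β = B at *
      field_simp
      clear * - hscα hscβ
      grind
    rw [i₁] at k₁
    rw [i₂] at k₂
    have j₁ := le_of_sq_le_sq k₁ (by positivity)
    have j₂ := le_of_sq_le_sq k₂ (by positivity)
    have j : dist (σ s) (τ s) ≤ √N := by
      refine (dist_triangle _ (ρ r) _).trans ((add_le_add j₁ j₂).trans_eq ?_)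
      rw [← add_mul, ← add_div, div_self hS0.ne', one_mul]
    exact (pow_le_pow_left₀ dist_nonneg j 2).trans_eq (Real.sq_sqrt hN)
  refine le_of_forall_pos_le_add fun ε hε => ?_
  have := main (geodesicAngle p x y + ε / 2) (geodesicAngle p y z + ε / 2)
    (by linarith) (by linarith)
  linarith

theorem geodesicAngle_eq_pi {q e : X} {σ : ℝ → X} (hσ : IsGeodesic σ q e) {h : ℝ}
    (hh : h ∈ Ioo 0 (dist q e)) : geodesicAngle (σ h) q e = Real.pi := by
  have hh' := Ioo_subset_Icc_self hh
  have d1 := hσ.dist_source hh'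
  have d2 := hσ.dist_target hh'
  rw [dist_comm] at d1
  obtain ⟨σ₁, hσ₁⟩ := hX.geodesic (σ h) q
  obtain ⟨σ₂, hσ₂⟩ := hX.geodesic (σ h) e
  refine le_antisymm (geodesicAngle_le_pi _ _ _) (le_of_forall_gt fun θ hθ => ?_)
  obtain ⟨s, hs, t, ht, hst⟩ := hX.exists_comparisonAngle_lt
    (dist_pos.1 (by rw [d1]; exact hh.1)) (dist_pos.1 (by rw [d2]; linarith [hh.2])) hθ hσ₁ hσ₂
  refine lt_of_eq_of_lt ?_ hst
  have e1 := hσ₁.dist_source (Ioc_subset_Icc_self hs)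
  have e2 := hσ₂.dist_source (Ioc_subset_Icc_self ht)
  have e3 := hσ₁.dist_target (Ioc_subset_Icc_self hs)
  have e4 := hσ₂.dist_target (Ioc_subset_Icc_self ht)
  have hle : dist (σ₁ s) (σ₂ t) ≤ s + t := by
    have := dist_triangle_left (σ₁ s) (σ₂ t) (σ h)
    linarith
  have hge : s + t ≤ dist (σ₁ s) (σ₂ t) := by
    have := dist_triangle4 q (σ₁ s) (σ₂ t) e
    rw [dist_comm q (σ₁ s)] at this
    linarith
  have hs0 := hs.1
  have ht0 := ht.1
  rw [comparisonAngle, e1, e2, le_antisymm hle hge, ← Real.arccos_neg_one]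
  congr 1
  field_simp
  ring

theorem pi_le_angle_add_angle {q e a : X} {σ : ℝ → X} (hσ : IsGeodesic σ q e) {h : ℝ}
    (hh : h ∈ Ioo 0 (dist q e)) (ha : σ h ≠ a) :
    Real.pi ≤ geodesicAngle (σ h) a q + geodesicAngle (σ h) a e := by
  have d1 := hσ.dist_source (Ioo_subset_Icc_self hh)
  have d2 := hσ.dist_target (Ioo_subset_Icc_self hh)
  have := hX.angle_triangle (p := σ h) (x := q) (y := a) (z := e)
    (dist_pos.1 (by rw [dist_comm, d1]; exact hh.1)) ha
    (dist_pos.1 (by rw [d2]; linarith [hh.2]))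
  rwa [hX.geodesicAngle_eq_pi hσ hh, geodesicAngle_comm _ q a] at this

/-! ### Contraction towards a point, convexity, semicontinuity. -/

/-- Seen from `e`, both points approach by the same amount `h`, so the difference of their distances
to `e` is kept, while the rest of the squared distance is multiplied by `a * b ≤ 1`. -/
theorem dist_toward_le {x y e : X} (hx : x ≠ e) (hy : y ≠ e) {σ ρ : ℝ → X} (hσ : IsGeodesic σ x e)
    (hρ : IsGeodesic ρ y e) {h : ℝ} (h0 : 0 ≤ h) (hhx : h ≤ dist x e) (hhy : h ≤ dist y e) :
    dist (σ h) (ρ h) ≤ dist x y := by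
  have hA := dist_pos.2 hx
  have hB := dist_pos.2 hy
  have hc := abs_dist_sub_le x y e
  set a := (dist x e - h) / dist x e with ha
  set b := (dist y e - h) / dist y e with hb
  have ha1 : a ∈ Icc (0 : ℝ) 1 :=
    ⟨div_nonneg (by linarith) hA.le, (div_le_one hA).2 (by linarith)⟩
  have hb1 : b ∈ Icc (0 : ℝ) 1 :=
    ⟨div_nonneg (by linarith) hB.le, (div_le_one hB).2 (by linarith)⟩
  have key := hX.comparison_sq hσ.reverse hρ.reverse ha1 hb1
  have ea : a * dist x e = dist x e - h := by rw [ha]; field_simp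
  have eb : b * dist y e = dist y e - h := by rw [hb]; field_simp
  rw [dist_comm e x, dist_comm e y, ea, eb] at key
  simp only [sub_sub_cancel] at key
  refine le_of_sq_le_sq (key.trans ?_) dist_nonneg
  have hab : a * b ≤ 1 := mul_le_one₀ ha1.2 hb1.1 hb1.2
  have hsq := sq_le_sq' (by linarith [neg_abs_le (dist x e - dist y e)])
    ((le_abs_self _).trans hc)
  have e : (a * dist x e - b * dist y e) ^ 2 = (dist x e - dist y e) ^ 2 := by rw [ea, eb]; ring
  nlinarith [mul_le_mul_of_nonneg_left hsq (sub_nonneg.2 hab)]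

theorem dist_geodesic_le {p x p' x' : X} {σ ρ : ℝ → X} (hσ : IsGeodesic σ p x)
    (hρ : IsGeodesic ρ p' x') {a : ℝ} (ha : a ∈ Icc (0 : ℝ) 1) :
    dist (σ (a * dist p x)) (ρ (a * dist p' x')) ≤ dist p p' + dist x x' := by
  have key : ∀ {p x y : X} {σ ρ : ℝ → X}, IsGeodesic σ p x → IsGeodesic ρ p y → ∀ {a : ℝ},
      a ∈ Icc (0 : ℝ) 1 → dist (σ (a * dist p x)) (ρ (a * dist p y)) ≤ dist x y := by
    intro p x y σ ρ hσ hρ a ha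
    refine le_of_sq_le_sq ((hX.comparison_sq hσ hρ ha ha).trans ?_) dist_nonneg
    nlinarith [mul_le_one₀ ha.2 ha.1 ha.2, sq_nonneg (dist x y)]
  obtain ⟨τ, hτ⟩ := hX.geodesic p x'
  have h1 := key hσ hτ ha
  have h2 := key hτ.reverse hρ.reverse (a := 1 - a) ⟨by linarith [ha.2], by linarith [ha.1]⟩
  rw [dist_comm x' p, dist_comm x' p'] at h2
  have e : ∀ d : ℝ, d - (1 - a) * d = a * d := fun d => by ring
  simp only [e] at h2
  linarith [dist_triangle (σ (a * dist p x)) (τ (a * dist p x')) (ρ (a * dist p' x'))]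

/-- The angle is an infimum of comparison angles at points dividing the sides in fixed proportions,
and each of these depends continuously on the three vertices by `dist_geodesic_le`. -/
theorem geodesicAngle_upperSemicontinuous {p x y : X} (hx : p ≠ x) (hy : p ≠ y) {ε : ℝ}
    (hε : 0 < ε) : ∃ κ > 0, ∀ p' x' y', dist p' p < κ → dist x' x < κ → dist y' y < κ →
      geodesicAngle p' x' y' < geodesicAngle p x y + ε := by
  choose g hg using hX.geodesic
  obtain ⟨s, hs, t, ht, hst⟩ := hX.exists_comparisonAngle_lt hx hy
    (lt_add_of_pos_right _ hε) (hg p x) (hg p y)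
  have hdx := dist_pos.2 hx
  have hdy := dist_pos.2 hy
  have cont : ∀ a ∈ Icc (0 : ℝ) 1, Continuous fun z : X × X => g z.1 z.2 (a * dist z.1 z.2) := by
    intro a ha
    refine continuous_iff_continuousAt.2 fun z => tendsto_iff_dist_tendsto_zero.2 ?_
    refine squeeze_zero (fun _ => dist_nonneg)
      (fun w => hX.dist_geodesic_le (hg w.1 w.2) (hg z.1 z.2) ha) ?_
    have : Continuous fun w : X × X => dist w.1 z.1 + dist w.2 z.2 := by fun_prop
    simpa using this.tendsto z
  set a := s / dist p x with ha
  set b := t / dist p y with hb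
  have ha0 : 0 < a := div_pos hs.1 hdx
  have hb0 : 0 < b := div_pos ht.1 hdy
  have ha1 : a ≤ 1 := (div_le_one hdx).2 hs.2
  have hb1 : b ≤ 1 := (div_le_one hdy).2 ht.2
  have eas : a * dist p x = s := by rw [ha]; field_simp
  have ebt : b * dist p y = t := by rw [hb]; field_simp
  have ca : Continuous fun z : X × X × X => g z.1 z.2.1 (a * dist z.1 z.2.1) :=
    (cont a ⟨ha0.le, ha1⟩).comp (f := fun z : X × X × X => (z.1, z.2.1)) (by fun_prop)
  have cb : Continuous fun z : X × X × X => g z.1 z.2.2 (b * dist z.1 z.2.2) :=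
    (cont b ⟨hb0.le, hb1⟩).comp (f := fun z : X × X × X => (z.1, z.2.2)) (by fun_prop)
  have cc : ContinuousAt (fun z : X × X × X => comparisonAngle z.1
      (g z.1 z.2.1 (a * dist z.1 z.2.1)) (g z.1 z.2.2 (b * dist z.1 z.2.2))) (p, x, y) := by
    refine continuousAt_comparisonAngle continuous_fst.continuousAt ca.continuousAt
      cb.continuousAt ?_ ?_
    · simpa only [eas] using (hg p x).ne_of_mem hs
    · simpa only [ebt] using (hg p y).ne_of_mem ht
  have ev : ∀ᶠ z : X × X × X in 𝓝 (p, x, y),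
      geodesicAngle z.1 z.2.1 z.2.2 < geodesicAngle p x y + ε := by
    have e1 := cc.eventually_lt_const (u := geodesicAngle p x y + ε)
      (by simpa only [eas, ebt] using hst)
    have e2 : ∀ᶠ z : X × X × X in 𝓝 (p, x, y), z.1 ≠ z.2.1 :=
      (isOpen_ne_fun (by fun_prop) (by fun_prop)).mem_nhds hx
    have e3 : ∀ᶠ z : X × X × X in 𝓝 (p, x, y), z.1 ≠ z.2.2 :=
      (isOpen_ne_fun (by fun_prop) (by fun_prop)).mem_nhds hy
    filter_upwards [e1, e2, e3] with z h1 h2 h3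
    refine (geodesicAngle_le (hg _ _) (hg _ _) ⟨?_, ?_⟩ ⟨?_, ?_⟩).trans_lt h1
    · exact mul_pos ha0 (dist_pos.2 h2)
    · exact mul_le_of_le_one_left dist_nonneg ha1
    · exact mul_pos hb0 (dist_pos.2 h3)
    · exact mul_le_of_le_one_left dist_nonneg hb1
  obtain ⟨κ, hκ, h⟩ := Metric.eventually_nhds_iff.1 ev
  refine ⟨κ, hκ, fun p' x' y' h1 h2 h3 => h (y := (p', x', y')) ?_⟩
  simp only [Prod.dist_eq]
  exact max_lt h1 (max_lt h2 h3)

end IsCAT0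

end Angles

end Pursuit

namespace Pursuit

/-! ### Polygons of the evader, the budget and the deviation. -/

section EdgePaths

variable {X : Type*} [MetricSpace X]

/-- `EdgePath γ δ a u w R`: there is a polygon inscribed in `γ : [a, w] → X` with sides of length
at most `δ`, with last side from `γ u` to `γ w` and with total rotation `R`. -/
inductive EdgePath (γ : ℝ → X) (δ : ℝ≥0) (a : ℝ) : ℝ → ℝ → ℝ → Prop
  | single {w : ℝ} : a ≤ w → γ a ≠ γ w → nndist (γ a) (γ w) ≤ δ → EdgePath γ δ a a w 0
  | snoc {u w w' R : ℝ} : EdgePath γ δ a u w R → w ≤ w' → γ w ≠ γ w' → nndist (γ w) (γ w') ≤ δ →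
      EdgePath γ δ a w w' (R + (Real.pi - geodesicAngle (γ w) (γ u) (γ w')))

namespace EdgePath

variable {γ : ℝ → X} {δ : ℝ≥0} {a u w R : ℝ}

theorem ne (h : EdgePath γ δ a u w R) : γ u ≠ γ w := by
  cases h <;> assumption

/-- Sides must be nontrivial, so while the evader is back at the same point the last parameter is
moved instead of adding a side. -/
theorem extend (h : EdgePath γ δ a u w R) {w' : ℝ} (hw : w ≤ w') (he : γ w' = γ w) :
    EdgePath γ δ a u w' R := by
  cases h with
  | single h1 h2 h3 => exact .single (h1.trans hw) (by rwa [he]) (by rwa [he])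
  | snoc h1 h2 h3 h4 =>
    rw [← he]
    exact .snoc h1 (h2.trans hw) (by rwa [he]) (by rwa [he])

theorem exists_inscribedPolygon (h : EdgePath γ δ a u w R) :
    ∃ (σ : InscribedPolygon γ a w) (m : ℕ), σ.n = m + 1 ∧ σ.t m = u ∧ σ.mesh ≤ δ ∧
      σ.rotation = R := by
  induction h with
  | @single w h1 h2 h3 =>
    refine ⟨⟨1, fun i => if i = 0 then a else w, by simp, by simp, ?_, ?_⟩, 0, rfl, by simp, ?_, ?_⟩
    · intro i hi
      obtain rfl : i = 0 := by omega
      simpa using h1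
    · intro i hi
      obtain rfl : i = 0 := by omega
      simpa using h2
    · simpa [InscribedPolygon.mesh, InscribedPolygon.vertex] using h3
    · simp [InscribedPolygon.rotation]
  | @snoc u w w' R _ h2 h3 h4 ih =>
    obtain ⟨σ, m, hn, hm, hmesh, hrot⟩ := ih
    have hlast : σ.t (m + 1) = w := by rw [← hn, σ.last]
    have ht : ∀ i, i ≤ m + 1 → (if i ≤ m + 1 then σ.t i else w') = σ.t i := fun i hi => if_pos hi
    have ht' : (if m + 2 ≤ m + 1 then σ.t (m + 2) else w') = w' := if_neg (by omega)
    refine ⟨⟨m + 2, fun i => if i ≤ m + 1 then σ.t i else w', ?_, ht', ?_, ?_⟩, m + 1, rfl, ?_, ?_,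
      ?_⟩
    · simp [σ.first]
    · intro i hi
      rcases Nat.lt_succ_iff_lt_or_eq.1 hi with hi | rfl
      · simpa only [ht i (by omega), ht (i + 1) (by omega)] using σ.mono i (by omega)
      · simpa only [le_refl, if_true, ht', hlast] using h2
    · intro i hi
      rcases Nat.lt_succ_iff_lt_or_eq.1 hi with hi | rfl
      · simpa only [ht i (by omega), ht (i + 1) (by omega)] using σ.nondegenerate i (by omega)
      · simpa only [le_refl, if_true, ht', hlast] using h3
    · simpa using hlast
    · rw [InscribedPolygon.mesh, hn, Finset.sup_le_iff] at hmesh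
      refine Finset.sup_le fun i hi => ?_
      simp only [InscribedPolygon.vertex] at hmesh ⊢
      rcases Nat.lt_succ_iff_lt_or_eq.1 (Finset.mem_range.1 hi) with hi | rfl
      · simpa only [ht i (by omega), ht (i + 1) (by omega)] using hmesh i (by simpa using hi)
      · simpa only [le_refl, if_true, ht', hlast] using h4
    · rw [InscribedPolygon.rotation, hn] at hrot
      simp only [InscribedPolygon.rotation, InscribedPolygon.vertex] at hrot ⊢
      change ∑ i ∈ Finset.range (m + 1), _ = _
      rw [Finset.sum_range_succ]
      congr 1
      · rw [← hrot]
        refine Finset.sum_congr rfl fun i hi => ?_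
        have hi := Finset.mem_range.1 hi
        rw [ht i (by omega), ht (i + 1) (by omega), ht (i + 2) (by omega)]
      · rw [ht m (by omega), ht (m + 1) le_rfl, ht', hlast, hm]

end EdgePath

/-- `V q` is an upper bound, provided by the motion of the evader up to the time `s`, for the
rotation of a pursuer which is at `q` at this time. -/
def Budget (E : ℝ → X) (δ : ℝ≥0) (s : ℝ) (V : X → ℝ) : Prop :=
  (E s = E 0 ∧ V = 0) ∨ ∃ u R, EdgePath E δ 0 u s R ∧
    V = fun q => Real.pi + R - geodesicAngle (E s) (E u) q

theorem Budget.slide (hX : IsCAT0 X) {E : ℝ → X} {δ : ℝ≥0} {s : ℝ} {V : X → ℝ}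
    (hV : Budget E δ s V) {q : X} {σ : ℝ → X} (hσ : IsGeodesic σ q (E s)) {h : ℝ}
    (hh : h ∈ Ioo 0 (dist q (E s))) : V (σ h) = V q := by
  rcases hV with ⟨-, rfl⟩ | ⟨u, R, hp, rfl⟩
  · rfl
  · have := hX.geodesicAngle_initial hσ.reverse hp.ne.symm (s := dist q (E s) - h)
      ⟨by linarith [hh.2], by rw [dist_comm (E s)]; linarith [hh.1]⟩
    simp only [sub_sub_cancel] at this
    simp only
    rw [geodesicAngle_comm _ _ (σ h), this, geodesicAngle_comm]

/-- The new side adds the rotation `π - ∠(E u, E s')` at `E s`. The angle sum of `q, E s, E s'` and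
the triangle inequality for the directions of `E u`, `q`, `E s'` at `E s` leave a gain of at least
the angle at `q`. -/
theorem Budget.step (hX : IsCAT0 X) {E : ℝ → X} {δ : ℝ≥0} {s s' : ℝ} {V : X → ℝ}
    (hV : Budget E δ s V) (h0 : 0 ≤ s) (hs : s ≤ s') (hδ : nndist (E s) (E s') ≤ δ) {q : X}
    (hq : q ≠ E s) (hq' : q ≠ E s') :
    ∃ V', Budget E δ s' V' ∧ V q + geodesicAngle q (E s) (E s') ≤ V' q := by
  by_cases he : E s' = E s
  · refine ⟨V, ?_, by rw [he, hX.geodesicAngle_self hq, add_zero]⟩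
    rcases hV with ⟨h, rfl⟩ | ⟨u, R, hp, rfl⟩
    · exact .inl ⟨he.trans h, rfl⟩
    · exact .inr ⟨u, R, hp.extend hs he, by rw [he]⟩
  · have hsum := hX.angle_sum_le_pi hq (Ne.symm he) hq'
    rw [geodesicAngle_comm (E s') q] at hsum
    rcases hV with ⟨h, rfl⟩ | ⟨u, R, hp, rfl⟩
    -- The first side of the polygon may start at parameter `0` because `E s = E 0`. Here the
    -- summand `π` enters the budget.
    · refine ⟨_, .inr ⟨0, 0, .single (h0.trans hs) ?_ ?_, rfl⟩, ?_⟩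
      · rw [← h]; exact Ne.symm he
      · rwa [← h]
      · rw [← h]
        simp only [Pi.zero_apply]
        linarith [geodesicAngle_nonneg (E s) q (E s')]
    · refine ⟨_, .inr ⟨s, _, hp.snoc hs (Ne.symm he) hδ, rfl⟩, ?_⟩
      simp only
      linarith [hX.angle_triangle hp.ne.symm hq.symm (Ne.symm he)]

open Classical in
/-- The deviation of a pursuer from the side `[a, q]`: at `a` it set out in the direction of `e₀`,
and at `q` it is heading for `e`. -/
noncomputable def deviation (a q e e₀ : X) : ℝ :=
  if q = a then geodesicAngle a e e₀
  else geodesicAngle a q e₀ + (Real.pi - geodesicAngle q a e)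

/-- In the generic case the angle sum of the triangle `a, q, σ h` pays for the change of direction
at `a`, since the two angles at `σ h` on either side of the geodesic add up to at least `π`. -/
theorem deviation_slide (hX : IsCAT0 X) {a q e e₀ : X} (ha : a ≠ e₀) {σ : ℝ → X}
    (hσ : IsGeodesic σ q e) {h : ℝ} (hh : h ∈ Ioo 0 (dist q e)) :
    deviation a (σ h) e e₀ ≤ deviation a q e e₀ := by
  have hqe : q ≠ e := dist_pos.1 (hh.1.trans hh.2)
  have hhc := Ioo_subset_Ioc_self hh
  have hne : q ≠ σ h := hσ.ne_of_mem hhc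
  unfold deviation
  by_cases hq : q = a
  · subst hq
    rw [if_pos rfl, if_neg hne.symm, hX.geodesicAngle_initial hσ ha hhc,
      hX.geodesicAngle_eq_pi hσ hh, sub_self, add_zero]
  rw [if_neg hq]
  have hinit := hX.geodesicAngle_initial hσ hq hhc
  by_cases hq' : σ h = a
  -- The slide ends exactly at `a`: then `q` was heading straight back, and its deviation was at
  -- least `π`.
  · rw [if_pos hq']
    rw [hq', hX.geodesicAngle_self hq] at hinit
    rw [geodesicAngle_comm q a e, ← hinit]
    linarith [geodesicAngle_le_pi a e e₀, geodesicAngle_nonneg a q e₀]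
  · rw [if_neg hq']
    have h1 := hX.angle_triangle (x := σ h) (y := q) (z := e₀) (Ne.symm hq') (Ne.symm hq) ha
    have h2 := hX.angle_sum_le_pi hq' (Ne.symm hq) hne.symm
    have h3 := hX.pi_le_angle_add_angle hσ hh hq'
    rw [geodesicAngle_comm q (σ h) a, geodesicAngle_comm q a (σ h), hinit,
      geodesicAngle_comm q e a] at h2
    linarith

theorem deviation_evader (hX : IsCAT0 X) {a q e e' e₀ : X} (ha : a ≠ e₀) (he : q ≠ e)
    (he' : q ≠ e') :
    deviation a q e' e₀ ≤ deviation a q e e₀ + geodesicAngle q e e' := by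
  unfold deviation
  split_ifs with hq
  · subst hq
    have := hX.angle_triangle he' he ha
    rw [geodesicAngle_comm q e' e] at this
    linarith
  · have := hX.angle_triangle hq he' he
    rw [geodesicAngle_comm q e' e] at this
    linarith

end EdgePaths

/-! ### Following the true pursuer. -/

section Chase

variable {X : Type*} [MetricSpace X] {E P : ℝ → X} {δ : ℝ≥0}

/-- One slide of length `s' - s` followed by one jump of the evader. The bounds by `m / 2` keep `q`
away from both positions of the evader, so that all angles make sense. The conclusion quantifies
over `a`, `e₀` and `c` after `q'` and `V'`, as these do not depend on the side being followed. -/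
theorem chase_step (hX : IsCAT0 X) {m s s' : ℝ} {q : X} {V : X → ℝ} {σ : ℝ → X}
    (hs0 : 0 ≤ s) (hss' : s < s') (hV : Budget E δ s V) (hE : nndist (E s) (E s') ≤ δ)
    (hm : m ≤ dist (P s) (E s)) (hm' : m ≤ dist (P s') (E s')) (hh : s' - s < m / 2)
    (hσ : IsGeodesic σ (P s) (E s))
    (hq : dist q (P s) + dist (P s') (σ (s' - s)) < m / 2) :
    ∃ q' V', Budget E δ s' V' ∧ dist q' (P s') ≤ dist q (P s) + dist (P s') (σ (s' - s)) ∧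
      ∀ a e₀ c, a ≠ e₀ → c + deviation a q (E s) e₀ ≤ V q →
        c + deviation a q' (E s') e₀ ≤ V' q' := by
  obtain ⟨τ, hτ⟩ := hX.geodesic q (E s)
  set h := s' - s with hdef
  have hpos : 0 < h := sub_pos.2 hss'
  have hqP : dist q (P s) < m / 2 := by linarith [dist_nonneg (x := P s') (y := σ h)]
  have hqE : h < dist q (E s) := by
    linarith [dist_triangle_left (P s) (E s) q]
  have hPE : h < dist (P s) (E s) := by linarith
  have hmem : h ∈ Ioo 0 (dist q (E s)) := ⟨hpos, hqE⟩
  have hcon := hX.dist_toward_le (dist_pos.1 (hpos.trans hqE)) (dist_pos.1 (hpos.trans hPE)) hτ hσ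
    hpos.le hqE.le hPE.le
  have hd : dist (τ h) (P s') ≤ dist q (P s) + dist (P s') (σ h) := by
    linarith [dist_triangle_right (τ h) (P s') (σ h)]
  have hne : τ h ≠ E s := by
    rw [← dist_pos, hτ.dist_target (Ioo_subset_Icc_self hmem)]
    linarith
  have hne' : τ h ≠ E s' := by
    intro heq
    rw [heq, dist_comm] at hd
    linarith
  obtain ⟨V', hV', hle⟩ := hV.step hX hs0 hss'.le hE hne hne'
  refine ⟨τ h, V', hV', hd, fun a e₀ c hae hc => ?_⟩
  have h1 := deviation_slide hX hae hτ hmem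
  have h2 := deviation_evader hX hae hne hne'
  rw [hV.slide hX hτ hmem] at hle
  linarith

/-- Continuous induction on time along one side of the pursuer's polygon, starting with deviation
`0` at `a`. -/
theorem chase_segment (hX : IsCAT0 X) {T m κ : ℝ}
    (hm : ∀ s ∈ Icc 0 T, m ≤ dist (P s) (E s)) (hκ : κ ≤ m / 2) (hδ : 0 < δ)
    (hE : ∀ s ∈ Icc 0 T, ∀ s' ∈ Icc 0 T, dist (E s) (E s') ≤ |s - s'|)
    (hP : ∀ s ∈ Icc 0 T, ∀ s' ∈ Icc 0 T, dist (P s) (P s') ≤ |s - s'|)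
    (hv : ∀ s ∈ Icc 0 T, HasRightVelocityToward P s (E s))
    {s₀ s₁ : ℝ} (h0 : 0 ≤ s₀) (h01 : s₀ ≤ s₁) (h1 : s₁ ≤ T) {a : X} {V₀ : X → ℝ}
    (hV₀ : Budget E δ s₀ V₀) (ha : dist a (P s₀) < κ) :
    ∃ q V, Budget E δ s₁ V ∧ dist q (P s₁) < κ ∧
      V₀ a + deviation a q (E s₁) (E s₀) ≤ V q := by
  have hsub : Icc s₀ s₁ ⊆ Icc 0 T := Icc_subset_Icc h0 h1
  have hm0 : 0 < m / 2 := (dist_nonneg.trans_lt ha).trans_le hκ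
  have haE : a ≠ E s₀ := by
    rintro rfl
    have := hm s₀ ⟨h0, h01.trans h1⟩
    rw [dist_comm] at this
    linarith
  set g := κ - dist a (P s₀) with hg
  have hg0 : 0 < g := sub_pos.2 ha
  -- The accumulated drift `ε * (s - s₀)` is then at most `g / 2`, leaving room for `η`; the `+ 1`
  -- covers `s₀ = s₁`.
  set ε := g / (2 * (s₁ - s₀ + 1)) with hε
  have hlen : 0 < s₁ - s₀ + 1 := by linarith
  have hε0 : 0 < ε := by positivity
  have hεlen : ∀ s ≤ s₁, ε * (s - s₀) ≤ g / 2 := by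
    intro s hs
    have : ε * (s₁ - s₀ + 1) = g / 2 := by rw [hε]; field_simp
    nlinarith
  let Good : ℝ → Prop := fun s => ∀ η > 0, ∃ q V, Budget E δ s V ∧
    dist q (P s) ≤ dist a (P s₀) + ε * (s - s₀) + η ∧ V₀ a + deviation a q (E s) (E s₀) ≤ V q
  have advance : ∀ s ∈ Icc s₀ s₁, ∀ s' ∈ Icc s₀ s₁, s < s' → s' - s ≤ δ → s' - s < m / 2 →
      ∀ σ, IsGeodesic σ (P s) (E s) → ∀ η > 0, η < g / 2 →
      ε * (s - s₀) + dist (P s') (σ (s' - s)) ≤ ε * (s' - s₀) + η / 2 →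
      (∃ q V, Budget E δ s V ∧ dist q (P s) ≤ dist a (P s₀) + ε * (s - s₀) + η / 2 ∧
        V₀ a + deviation a q (E s) (E s₀) ≤ V q) →
      ∃ q V, Budget E δ s' V ∧ dist q (P s') ≤ dist a (P s₀) + ε * (s' - s₀) + η ∧
        V₀ a + deviation a q (E s') (E s₀) ≤ V q := by
    rintro s hs s' hs' hss' hhδ hhm σ hσ η hη hηg hle ⟨q, V, hV, hq, hc⟩
    have hnn : nndist (E s) (E s') ≤ δ := by
      rw [← NNReal.coe_le_coe, coe_nndist]
      refine (hE s (hsub hs) s' (hsub hs')).trans ?_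
      rw [abs_sub_comm, abs_of_pos (sub_pos.2 hss')]
      exact hhδ
    have hlt : dist q (P s) + dist (P s') (σ (s' - s)) < m / 2 := by
      have := hεlen s' hs'.2
      linarith
    obtain ⟨q', V', hV', hd, hdev⟩ := chase_step hX (h0.trans hs.1) hss' hV hnn (hm s (hsub hs))
      (hm s' (hsub hs')) hhm hσ hlt
    exact ⟨q', V', hV', by linarith, hdev a _ _ haE hc⟩
  have weaken : ∀ s ∈ Icc s₀ s₁, (∀ η > 0, η < g / 2 → ∃ q V, Budget E δ s V ∧
      dist q (P s) ≤ dist a (P s₀) + ε * (s - s₀) + η ∧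
      V₀ a + deviation a q (E s) (E s₀) ≤ V q) → Good s := by
    intro s hs h η hη
    obtain ⟨q, V, hV, hq, hc⟩ := h (min η (g / 4)) (lt_min hη (by linarith))
      ((min_le_right _ _).trans_lt (by linarith))
    exact ⟨q, V, hV, hq.trans (by linarith [min_le_left η (g / 4)]), hc⟩
  have start : Good s₀ := fun η hη => by
    refine ⟨a, V₀, hV₀, by linarith, ?_⟩
    rw [deviation, if_pos rfl, hX.geodesicAngle_self haE, add_zero]
  have hδ' : (0 : ℝ) < δ := by exact_mod_cast hδ
  -- At a limit time one last step of length `l` suffices. Its error is at most `2 * l` by the speed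
  -- bound alone and is absorbed in half of `η`; this is why the induction hypothesis allows every
  -- `η > 0`.
  have fromLeft : ∀ s ∈ Ioc s₀ s₁, (∀ r ∈ Ico s₀ s, Good r) → Good s := by
    intro s hs hr
    refine weaken s (Ioc_subset_Icc_self hs) fun η hη hηg => ?_
    set l := min (min (δ : ℝ) (m / 4)) (min (η / 4) (s - s₀)) with hl
    have hl0 : 0 < l := lt_min (lt_min hδ' (by linarith)) (lt_min (by linarith) (sub_pos.2 hs.1))
    have hl1 : l ≤ δ := (min_le_left _ _).trans (min_le_left _ _)
    have hl2 : l ≤ m / 4 := (min_le_left _ _).trans (min_le_right _ _)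
    have hl3 : l ≤ η / 4 := (min_le_right _ _).trans (min_le_left _ _)
    have hl4 : l ≤ s - s₀ := (min_le_right _ _).trans (min_le_right _ _)
    have hmem : s - l ∈ Icc s₀ s₁ := ⟨by linarith, by linarith [hs.2]⟩
    obtain ⟨σ, hσ⟩ := hX.geodesic (P (s - l)) (E (s - l))
    refine advance (s - l) hmem s (Ioc_subset_Icc_self hs) (by linarith) (by linarith) (by linarith)
      σ hσ η hη hηg ?_ (hr _ ⟨hmem.1, by linarith⟩ _ (by linarith))
    rw [sub_sub_cancel]
    have e1 := hP s (hsub (Ioc_subset_Icc_self hs)) (s - l) (hsub hmem)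
    rw [sub_sub_cancel, abs_of_pos hl0] at e1
    have e2 := hσ.dist_source (s := l) ⟨hl0.le, by linarith [hm _ (hsub hmem)]⟩
    have := dist_triangle (P s) (P (s - l)) (σ l)
    nlinarith
  -- Here the right-hand velocity enters: a short step from `s` costs at most `ε` times its length.
  have toRight : ∀ s ∈ Ico s₀ s₁, Good s → ∃ r > s, ∀ s' ∈ Icc s₀ s₁, s < s' → s' < r → Good s' := by
    intro s hs hgood
    have hsI := Ico_subset_Icc_self hs
    obtain ⟨-, σ, hσ, hlim⟩ := hv s (hsub hsI)
    have ev := hlim.eventually (gt_mem_nhds hε0)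
    rw [eventually_nhdsWithin_iff] at ev
    obtain ⟨r, hr, hball⟩ := Metric.eventually_nhds_iff.1 ev
    set l := min r (min (δ : ℝ) (m / 2)) with hl
    have hl0 : 0 < l := lt_min hr (lt_min hδ' hm0)
    have hl1 : l ≤ r := min_le_left _ _
    have hl2 : l ≤ δ := (min_le_right _ _).trans (min_le_left _ _)
    have hl3 : l ≤ m / 2 := (min_le_right _ _).trans (min_le_right _ _)
    refine ⟨s + l, by linarith, fun s' hs' hss' hs'l => weaken s' hs' fun η hη hηg => ?_⟩
    refine advance s hsI s' hs' hss' (by linarith) (by linarith) σ hσ η hη hηg ?_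
      (hgood _ (by linarith))
    have hpos : 0 < s' - s := sub_pos.2 hss'
    have := hball (y := s' - s) (by rw [Real.dist_eq, sub_zero, abs_of_pos hpos]; linarith) hpos
    rw [div_lt_iff₀ hpos, add_sub_cancel] at this
    nlinarith
  -- Including all earlier times makes the set closed in the interval via `fromLeft`. The guard `r ≤
  -- s₁` is needed because the induction principle may ask for a point beyond `s₁`.
  have all : Icc s₀ s₁ ⊆ {s | ∀ r ∈ Icc s₀ s, r ≤ s₁ → Good r} := by
    apply IsClosed.Icc_subset_of_forall_exists_gt
    · rw [← closure_subset_iff_isClosed]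
      intro s hs
      have hsI : s ∈ Icc s₀ s₁ := by
        have := closure_mono inter_subset_right hs
        rwa [isClosed_Icc.closure_eq] at this
      have below : ∀ r ∈ Ico s₀ s, Good r := by
        intro r hr
        obtain ⟨s', hs', hrs'⟩ := mem_closure_iff.1 hs (Ioi r) isOpen_Ioi hr.2
        exact hrs'.1 r ⟨hr.1, le_of_lt hs'⟩ (hr.2.le.trans hsI.2)
      refine ⟨fun r hr _ => ?_, hsI⟩
      rcases hr.2.lt_or_eq with h | rfl
      · exact below r ⟨hr.1, h⟩
      · rcases hr.1.lt_or_eq with h | rfl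
        · exact fromLeft r ⟨h, hsI.2⟩ below
        · exact start
    · intro r hr _
      obtain rfl := le_antisymm hr.2 hr.1
      exact start
    · rintro s ⟨hs, hsI⟩ y hy
      obtain ⟨r, hr, hgood⟩ := toRight s hsI (hs s ⟨hsI.1, le_rfl⟩ hsI.2.le)
      obtain ⟨z, hz1, hz2⟩ := exists_between (lt_min hr hy)
      refine ⟨z, fun w hw hw1 => ?_, hz1, (hz2.trans_le (min_le_right _ _)).le⟩
      rcases le_or_gt w s with h | h
      · exact hs w ⟨hw.1, h⟩ hw1
      · exact hgood w ⟨hw.1, hw1⟩ h (hw.2.trans_lt (hz2.trans_le (min_le_left _ _)))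
  obtain ⟨q, V, hV, hq, hc⟩ := all ⟨h01, le_rfl⟩ s₁ ⟨h01, le_rfl⟩ le_rfl (g / 4) (by linarith)
  exact ⟨q, V, hV, by linarith [hεlen s₁ le_rfl], hc⟩

end Chase

end Pursuit

namespace Pursuit

/-! ### From prescribed polygons of the pursuer to total curvature. -/

section Main

variable {X : Type*} [MetricSpace X] {E P : ℝ → X} {δ : ℝ≥0}

/-- Induction over the sides: the final deviation of one side and the initial deviation of the next
together bound the rotation at their common vertex. The last summand is the unfinished rotation,
measured towards the evader. -/
theorem chase_polygon (hX : IsCAT0 X) {T m κ : ℝ}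
    (hm : ∀ s ∈ Icc 0 T, m ≤ dist (P s) (E s)) (hκ0 : 0 < κ) (hκ : κ ≤ m / 2) (hδ : 0 < δ)
    (hE : ∀ s ∈ Icc 0 T, ∀ s' ∈ Icc 0 T, dist (E s) (E s') ≤ |s - s'|)
    (hP : ∀ s ∈ Icc 0 T, ∀ s' ∈ Icc 0 T, dist (P s) (P s') ≤ |s - s'|)
    (hv : ∀ s ∈ Icc 0 T, HasRightVelocityToward P s (E s))
    {n : ℕ} {s : ℕ → ℝ} (hs0 : s 0 = 0) (hmono : ∀ i < n, s i ≤ s (i + 1))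
    (hs : ∀ i ≤ n, s i ∈ Icc 0 T) (hsep : ∀ i < n, 2 * κ ≤ dist (P (s i)) (P (s (i + 1))))
    (k : ℕ) (hk : k + 1 ≤ n) :
    ∃ (q : ℕ → X) (V : X → ℝ), Budget E δ (s (k + 1)) V ∧
      (∀ j ≤ k + 1, dist (q j) (P (s j)) < κ) ∧
      ∑ j ∈ Finset.range k, (Real.pi - geodesicAngle (q (j + 1)) (q j) (q (j + 2))) +
        (Real.pi - geodesicAngle (q (k + 1)) (q k) (E (s (k + 1)))) ≤ V (q (k + 1)) := by
  have sep : ∀ i < n, ∀ x y, dist x (P (s i)) < κ → dist y (P (s (i + 1))) < κ → y ≠ x := by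
    rintro i hi x y hx hy rfl
    linarith [hsep i hi, dist_triangle_left (P (s i)) (P (s (i + 1))) y]
  have away : ∀ i ≤ n, ∀ x, dist x (P (s i)) < κ → x ≠ E (s i) := by
    rintro i hi x hx rfl
    have := hm _ (hs i hi)
    rw [dist_comm] at this
    linarith
  induction k with
  | zero =>
    have h1 := hs 1 hk
    obtain ⟨q, V, hV, hq, hc⟩ := chase_segment hX hm hκ hδ hE hP hv (hs 0 (by omega)).1
      (hmono 0 (by omega)) h1.2 (a := P (s 0)) (V₀ := 0) (.inl ⟨by rw [hs0], rfl⟩)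
      (by rwa [dist_self])
    refine ⟨fun j => if j = 0 then P (s 0) else q, V, hV, fun j hj => ?_, ?_⟩
    · interval_cases j
      · simpa using hκ0
      · simpa using hq
    · rw [deviation, if_neg (sep 0 (by omega) _ _ (by rwa [dist_self]) hq)] at hc
      simp only [Pi.zero_apply, zero_add] at hc
      simp only [Finset.range_zero, Finset.sum_empty, zero_add, if_true, one_ne_zero, if_false]
      linarith [geodesicAngle_nonneg (P (s 0)) q (E (s 0))]
  | succ k ih =>
    obtain ⟨q, V, hV, hq, hc⟩ := ih (by omega)
    have h1 := hs (k + 1) (by omega)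
    have h2 := hs (k + 2) (by omega)
    obtain ⟨q', V', hV', hq', hc'⟩ := chase_segment hX hm hκ hδ hE hP hv h1.1
      (hmono (k + 1) (by omega)) h2.2 hV (hq (k + 1) le_rfl)
    have hne := sep (k + 1) (by omega) _ _ (hq (k + 1) le_rfl) hq'
    have hne' := sep k (by omega) _ _ (hq k (by omega)) (hq (k + 1) le_rfl)
    have hold : ∀ j ≤ k + 1, Function.update q (k + 2) q' j = q j := fun j hj =>
      Function.update_of_ne (by omega) _ _
    have hnew : Function.update q (k + 2) q' (k + 2) = q' := Function.update_self _ _ _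
    refine ⟨Function.update q (k + 2) q', V', hV', fun j hj => ?_, ?_⟩
    · rcases Nat.le_succ_iff.1 hj with hj | rfl
      · rw [hold j hj]; exact hq j hj
      · change dist (Function.update q (k + 2) q' (k + 2)) _ < κ
        rwa [hnew]
    · change _ + (Real.pi - geodesicAngle (Function.update q (k + 2) q' (k + 2)) _ _) ≤
        V' (Function.update q (k + 2) q' (k + 2))
      rw [hnew, hold (k + 1) le_rfl, Finset.sum_range_succ, hnew, hold (k + 1) le_rfl,
        hold k (by omega), Finset.sum_congr rfl (g := fun j =>
          Real.pi - geodesicAngle (q (j + 1)) (q j) (q (j + 2)))]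
      · rw [deviation, if_neg hne] at hc'
        -- The angle at the vertex is compared through the direction of the evader at that time.
        linarith [hX.angle_triangle hne' hne.symm (away (k + 1) (by omega) _ (hq _ le_rfl))]
      · intro j hj
        have := Finset.mem_range.1 hj
        rw [hold j (by omega), hold (j + 1) (by omega), hold (j + 2) (by omega)]

theorem IsSimplePursuit.exists_polygon (hX : IsCAT0 X) {I : Set ℝ} (hI : I.OrdConnected)
    (hI0 : IsLeast I 0) (hEP : IsSimplePursuit E P I) {t : ℝ} (ht : t ∈ I)
    (σ : InscribedPolygon P 0 t) (hδ : 0 < δ) {ε : ℝ} (hε : 0 < ε) :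
    σ.rotation ≤ Real.pi + ε ∨ ∃ τ : InscribedPolygon E 0 t, τ.mesh ≤ δ ∧
      σ.rotation ≤ τ.rotation + Real.pi + ε := by
  have hpi := Real.pi_pos
  obtain ⟨n, s, hs0, hsn, hmono, hnd⟩ := σ
  rcases Nat.lt_or_ge n 2 with hn | hn
  · left
    have : n - 1 = 0 := by omega
    simp only [InscribedPolygon.rotation, this, Finset.range_zero, Finset.sum_empty]
    linarith
  obtain ⟨k, rfl⟩ : ∃ k, n = k + 2 := ⟨n - 2, by omega⟩
  have hle_of_le : ∀ i ≤ k + 2, ∀ j ≤ i, s j ≤ s i := by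
    intro i hi j hj
    induction i, hj using Nat.le_induction with
    | base => exact le_rfl
    | succ i _ ih => exact (ih (by omega)).trans (hmono i (by omega))
  have hst : ∀ i ≤ k + 2, s i ≤ t := fun i hi => hsn ▸ hle_of_le _ le_rfl i hi
  have hlt : s (k + 1) < t := by
    refine lt_of_le_of_ne (hst _ (by omega)) fun h => hnd (k + 1) (by omega) ?_
    rw [h, ← hsn]
  have h0s : ∀ i ≤ k + 2, 0 ≤ s i := fun i hi => hs0 ▸ hle_of_le i hi 0 (Nat.zero_le _)
  have ht0 : 0 < t := (h0s (k + 1) (by omega)).trans_lt hlt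
  have hIt : Icc 0 t ⊆ I := hI.out hI0.1 ht
  have hE : ∀ r ∈ Icc 0 t, ∀ r' ∈ Icc 0 t, dist (E r) (E r') ≤ |r - r'| := by
    intro r hr r' hr'
    simpa [Real.dist_eq] using hEP.evader_speed.dist_le_mul r (hIt hr) r' (hIt hr')
  have hP : ∀ r ∈ Icc 0 t, ∀ r' ∈ Icc 0 t, dist (P r) (P r') ≤ |r - r'| := by
    have key : ∀ r ∈ Icc 0 t, ∀ r' ∈ Icc 0 t, r ≤ r' → dist (P r) (P r') ≤ r' - r := by
      intro r hr r' hr' hrr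
      have h1 := hEP.pursuer_speed (hIt hr) (hIt hr')
      have h2 := eVariationOn.edist_le P (s := I ∩ Icc r r') ⟨hIt hr, le_rfl, hrr⟩
        ⟨hIt hr', hrr, le_rfl⟩
      rw [h1, NNReal.coe_one, one_mul, edist_dist] at h2
      exact (ENNReal.ofReal_le_ofReal_iff (by linarith)).1 h2
    intro r hr r' hr'
    rcases le_total r r' with h | h
    · rw [abs_sub_comm, abs_of_nonneg (sub_nonneg.2 h)]
      exact key r hr r' hr' h
    · rw [abs_of_nonneg (sub_nonneg.2 h), dist_comm]
      exact key r' hr' r hr h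
  obtain ⟨κ, hκ0, hκsep, hκang⟩ : ∃ κ > 0,
      (∀ i < k + 2, 4 * κ ≤ dist (P (s i)) (P (s (i + 1)))) ∧
      ∀ i < k + 1, ∀ p x y, dist p (P (s (i + 1))) < κ → dist x (P (s i)) < κ →
        dist y (P (s (i + 2))) < κ →
        geodesicAngle p x y <
          geodesicAngle (P (s (i + 1))) (P (s i)) (P (s (i + 2))) + ε / (k + 1) := by
    have e1 : ∀ᶠ κ : ℝ in 𝓝[>] 0, ∀ i ∈ Finset.range (k + 2),
        4 * κ ≤ dist (P (s i)) (P (s (i + 1))) := by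
      rw [Filter.eventually_all_finset]
      intro i hi
      have hd := dist_pos.2 (hnd i (Finset.mem_range.1 hi))
      filter_upwards [Ioo_mem_nhdsGT (show 0 < dist (P (s i)) (P (s (i + 1))) / 4 by positivity)]
        with κ hκ
      linarith [hκ.2]
    have e2 : ∀ᶠ κ : ℝ in 𝓝[>] 0, ∀ i ∈ Finset.range (k + 1), ∀ p x y,
        dist p (P (s (i + 1))) < κ → dist x (P (s i)) < κ → dist y (P (s (i + 2))) < κ →
        geodesicAngle p x y <
          geodesicAngle (P (s (i + 1))) (P (s i)) (P (s (i + 2))) + ε / (k + 1) := by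
      rw [Filter.eventually_all_finset]
      intro i hi
      have hi := Finset.mem_range.1 hi
      obtain ⟨κ₀, hκ₀, h⟩ := hX.geodesicAngle_upperSemicontinuous (hnd i (by omega)).symm
        (hnd (i + 1) (by omega)) (ε := ε / (k + 1)) (by positivity)
      filter_upwards [Ioo_mem_nhdsGT hκ₀] with κ hκ p x y h1 h2 h3
      exact h p x y (h1.trans hκ.2) (h2.trans hκ.2) (h3.trans hκ.2)
    obtain ⟨κ, ⟨h1, h2⟩, h3⟩ := ((e1.and e2).and self_mem_nhdsWithin).exists
    exact ⟨κ, h3, fun i hi => h1 i (Finset.mem_range.2 hi), fun i hi => h2 i (Finset.mem_range.2 hi)⟩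
  have hδ' : (0 : ℝ) < δ := by exact_mod_cast hδ
  -- Capture may occur at `t`, so the chase stops slightly earlier, after the last interior vertex.
  -- Up to `T` the distance to the evader has a positive minimum, and neither curve moves far
  -- between `T` and `t`.
  obtain ⟨T, hTlow, hTt⟩ := exists_between (max_lt hlt (show t - min (κ / 2) δ < t from
    sub_lt_self _ (lt_min (by linarith) hδ')))
  have hsT : s (k + 1) < T := (le_max_left _ _).trans_lt hTlow
  have hT1 : t - min (κ / 2) δ < T := (le_max_right _ _).trans_lt hTlow
  have hT2 : t - T < κ / 2 := by linarith [min_le_left (κ / 2) (δ : ℝ)]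
  have hT3 : t - T < δ := by linarith [min_le_right (κ / 2) (δ : ℝ)]
  have hT0 : 0 ≤ T := (h0s (k + 1) (by omega)).trans hsT.le
  have hsubT : Icc 0 T ⊆ Icc 0 t := Icc_subset_Icc le_rfl hTt.le
  have hv : ∀ r ∈ Icc 0 T, HasRightVelocityToward P r (E r) := fun r hr =>
    hEP.pursues r (hIt (hsubT hr)) ⟨t, ht, hr.2.trans_lt hTt⟩
  obtain ⟨m, hm0, hm⟩ : ∃ m > 0, ∀ r ∈ Icc 0 T, m ≤ dist (P r) (E r) := by
    have cont : ∀ {γ : ℝ → X}, (∀ r ∈ Icc 0 t, ∀ r' ∈ Icc 0 t, dist (γ r) (γ r') ≤ |r - r'|) →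
        ContinuousOn γ (Icc 0 T) := fun {γ} h => by
      refine (LipschitzOnWith.of_dist_le_mul (K := 1) fun r hr r' hr' => ?_).continuousOn
      simpa [Real.dist_eq] using h r (hsubT hr) r' (hsubT hr')
    obtain ⟨r, hr, hmin⟩ := isCompact_Icc.exists_isMinOn (nonempty_Icc.2 hT0)
      (continuous_dist.comp_continuousOn ((cont hP).prodMk (cont hE)))
    exact ⟨_, dist_pos.2 (hv r hr).1, fun r' hr' => hmin hr'⟩
  set s' : ℕ → ℝ := fun i => if i < k + 2 then s i else T with hs'
  have hold : ∀ i < k + 2, s' i = s i := fun i hi => if_pos hi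
  have hnew : s' (k + 2) = T := if_neg (lt_irrefl _)
  have htT : t ∈ Icc 0 t := ⟨ht0.le, le_rfl⟩
  have hTT : T ∈ Icc 0 t := ⟨hT0, hTt.le⟩
  have hPT : dist (P T) (P t) < κ / 2 := by
    refine (hP T hTT t htT).trans_lt ?_
    rwa [abs_sub_comm, abs_of_pos (sub_pos.2 hTt)]
  have hclose : ∀ i ≤ k + 2, dist (P (s' i)) (P (s i)) ≤ κ / 2 := by
    intro i hi
    rcases hi.lt_or_eq with hi | rfl
    · rw [hold i hi, dist_self]; linarith
    · rw [hnew, hsn]; exact hPT.le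
  obtain ⟨q, V, hV, hq, hc⟩ := chase_polygon hX hm (κ := min (κ / 2) (m / 2))
    (lt_min (by linarith) (by linarith)) (min_le_right _ _) hδ
    (fun r hr r' hr' => hE r (hsubT hr) r' (hsubT hr'))
    (fun r hr r' hr' => hP r (hsubT hr) r' (hsubT hr')) hv (n := k + 2) (s := s')
    (by rw [hold 0 (by omega), hs0])
    (fun i hi => by
      rw [hold i hi]
      rcases Nat.lt_succ_iff_lt_or_eq.1 hi with hi | rfl
      · rw [hold (i + 1) (by omega)]; exact hmono i (by omega)
      · rw [hnew]; exact hsT.le)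
    (fun i hi => by
      rcases hi.lt_or_eq with hi | rfl
      · rw [hold i hi]; exact ⟨h0s i hi.le, (hle_of_le (k + 1) (by omega) i (by omega)).trans hsT.le⟩
      · rw [hnew]; exact ⟨hT0, le_rfl⟩)
    (fun i hi => by
      have h1 := hclose (i + 1) (by omega)
      have h2 := hκsep i hi
      rw [hold i hi]
      have := dist_triangle (P (s i)) (P (s' (i + 1))) (P (s (i + 1)))
      linarith [min_le_left (κ / 2) (m / 2)])
    (k + 1) le_rfl
  have hqs : ∀ i ≤ k + 2, dist (q i) (P (s i)) < κ := by
    intro i hi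
    have := dist_triangle (q i) (P (s' i)) (P (s i))
    linarith [hq i hi, hclose i hi, min_le_left (κ / 2) (m / 2)]
  have hrot : ∑ i ∈ Finset.range (k + 1),
      (Real.pi - geodesicAngle (P (s (i + 1))) (P (s i)) (P (s (i + 2)))) ≤ V (q (k + 2)) + ε := by
    have hsum : ∑ i ∈ Finset.range (k + 1),
        (Real.pi - geodesicAngle (P (s (i + 1))) (P (s i)) (P (s (i + 2)))) ≤
        ∑ i ∈ Finset.range (k + 1),
          ((Real.pi - geodesicAngle (q (i + 1)) (q i) (q (i + 2))) + ε / (k + 1)) := by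
      refine Finset.sum_le_sum fun i hi => ?_
      have hi := Finset.mem_range.1 hi
      linarith [hκang i hi _ _ _ (hqs (i + 1) (by omega)) (hqs i (by omega)) (hqs (i + 2) (by omega))]
    rw [Finset.sum_add_distrib, Finset.sum_const, Finset.card_range, nsmul_eq_mul] at hsum
    have : ((k + 1 : ℕ) : ℝ) * (ε / (k + 1)) = ε := by push_cast; field_simp
    have := geodesicAngle_le_pi (q (k + 2)) (q (k + 1)) (E (s' (k + 2)))
    linarith
  change ∑ i ∈ Finset.range (k + 1),
      (Real.pi - geodesicAngle (P (s (i + 1))) (P (s i)) (P (s (i + 2)))) ≤ _ ∨ ∃ τ, _ ∧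
    ∑ i ∈ Finset.range (k + 1),
      (Real.pi - geodesicAngle (P (s (i + 1))) (P (s i)) (P (s (i + 2)))) ≤ _
  rw [hnew] at hV
  rcases hV with ⟨-, rfl⟩ | ⟨u, R, hp, rfl⟩
  · left
    simp only [Pi.zero_apply] at hrot
    linarith
  right
  -- Completing the evader's polygon from `T` to `t` can only add rotation.
  obtain ⟨u', R', hp', hR⟩ : ∃ u' R', EdgePath E δ 0 u' t R' ∧ R ≤ R' := by
    by_cases he : E t = E T
    · exact ⟨u, R, hp.extend hTt.le he, le_rfl⟩
    · refine ⟨T, _, hp.snoc hTt.le (Ne.symm he) ?_, ?_⟩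
      · rw [← NNReal.coe_le_coe, coe_nndist]
        refine (hE T hTT t htT).trans ?_
        rw [abs_sub_comm, abs_of_pos (sub_pos.2 hTt)]
        exact hT3.le
      · linarith [geodesicAngle_le_pi (E T) (E u) (E t)]
  obtain ⟨τ, -, -, -, hmesh, hτ⟩ := hp'.exists_inscribedPolygon
  refine ⟨τ, hmesh, hrot.trans ?_⟩
  simp only
  linarith [geodesicAngle_nonneg (E T) (E u) (q (k + 2))]

end Main

end Pursuit

/-- The time interval `I` is `[0, ∞)`, `[0, T)` or `[0, T]`. -/
theorem mainTheorem11 {X : Type*} [MetricSpace X] (hX : Pursuit.IsCAT0 X)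
    (I : Set ℝ) (hI : I.OrdConnected) (hI0 : IsLeast I 0)
    (E P : ℝ → X) (hEP : Pursuit.IsSimplePursuit E P I) :
    ∀ t ∈ I, Pursuit.totalCurvature P 0 t ≤
      Pursuit.totalCurvature E 0 t + ENNReal.ofReal Real.pi := by
  intro t ht
  -- Every polygon inscribed in `P` satisfies the bound, not only the fine ones; fineness matters
  -- only on the side of `E`.
  refine limsup_le_of_le (by isBoundedDefault) (Eventually.of_forall fun σ => ?_)
  refine ENNReal.le_of_forall_pos_le_add fun ε hε hfin => ?_
  have hε2 : (0 : ℝ) < ε / 2 := by positivity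
  have hfin' : Pursuit.totalCurvature E 0 t ≠ ⊤ := (ENNReal.add_lt_top.1 hfin).1.ne
  have ev := eventually_lt_of_limsup_lt (show Pursuit.totalCurvature E 0 t <
    Pursuit.totalCurvature E 0 t + ENNReal.ofReal (ε / 2) from
      ENNReal.lt_add_right hfin' (by simpa using hε))
  obtain ⟨U, hU, hUsub⟩ := Filter.mem_comap.1 ev
  obtain ⟨δ, hδ, hball⟩ := NNReal.nhds_zero_basis.mem_iff.1 hU
  have hsplit : ∀ A : ℝ≥0∞, A + ENNReal.ofReal (ε / 2) + ENNReal.ofReal Real.pi +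
      ENNReal.ofReal (ε / 2) = A + ENNReal.ofReal Real.pi + ε := by
    intro A
    rw [add_right_comm A, add_assoc _ (ENNReal.ofReal (ε / 2)), ← ENNReal.ofReal_add hε2.le hε2.le,
      add_halves, ENNReal.ofReal_coe_nnreal]
  -- `δ / 2` turns the bound `≤` on the mesh into the strict bound defining the neighbourhood. The
  -- first alternative is needed because a motionless evader has no inscribed polygon when `t > 0`.
  rcases hEP.exists_polygon hX hI hI0 ht σ (half_pos hδ) hε2 with h | ⟨τ, hτ, h⟩
  · refine (ENNReal.ofReal_le_ofReal h).trans ?_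
    rw [ENNReal.ofReal_add Real.pi_pos.le hε2.le, ← hsplit]
    gcongr
    exact le_add_self
  · have hlt : ENNReal.ofReal τ.rotation <
        Pursuit.totalCurvature E 0 t + ENNReal.ofReal (ε / 2) :=
      hUsub (hball (lt_of_le_of_lt hτ (NNReal.half_lt_self hδ.ne')))
    refine (ENNReal.ofReal_le_ofReal h).trans ?_
    rw [← hsplit]
    exact ENNReal.ofReal_add_le.trans
      (add_le_add_left (ENNReal.ofReal_add_le.trans (add_le_add_left hlt.le _)) _)
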